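/- A loop $(G,\circ,e)$ is a set $G$ with a binary operation $\circ$ such that for all $a,b\in G$ there are a unique $x\in G$ with $a\circ x=b$ (written $x=a\backslash b$) and a unique $y\in G$ with $y\circ a=b$ (written $y=b/a$), and with an element $e\in G$ such that $a\circ e=a=e\circ a$ for all $a\in G$. A loop on $\mathbb{R}$ is smooth if the maps $(a,b)\mapsto a\circ b$, $(a,b)\mapsto a\backslash b$ and $(b,a)\mapsto b/a$ from $\mathbb{R}^2$ to $\mathbb{R}$ are infinitely differentiable. An invariant right measure on a loop on $\mathbb{R}$ is a nonzero $\sigma$-finite Borel measure $\mu$ on $\mathbb{R}$ such that, for every $v\in\mathbb{R}$, the image of $\mu$ under the right translation $\theta\mapsto\theta\circ v$ equals $\mu$. Theorem. There exists a smooth loop on the real line that admits no invariant right measure. -/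

import Mathlib

open scoped ContDiff

/-- An algebraic loop on `G`: a set with a binary operation such that, for all `a` and `b`, the
equations `a ∘ x = b` and `y ∘ a = b` have unique solutions, and with a two-sided identity. -/
structure AlgLoop (G : Type*) where
  /-- The binary operation `a ∘ b`. -/
  op : G → G → G
  /-- The identity element. -/
  e : G
  existsUnique_left : ∀ a b : G, ∃! x : G, op a x = b
  existsUnique_right : ∀ a b : G, ∃! y : G, op y a = b
  op_e : ∀ a : G, op a e = a
  e_op : ∀ a : G, op e a = a

namespace AlgLoop

/-- Left division `a \ b`: the unique `x` with `a ∘ x = b`. -/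
noncomputable def ldiv {G : Type*} (L : AlgLoop G) (a b : G) : G :=
  (L.existsUnique_left a b).choose

/-- Right division `b / a`: the unique `y` with `y ∘ a = b`. -/
noncomputable def rdiv {G : Type*} (L : AlgLoop G) (b a : G) : G :=
  (L.existsUnique_right a b).choose

/-- A smooth loop on a real normed space: the operation and both divisions are infinitely
differentiable, jointly in their two arguments. -/
structure IsSmooth {G : Type*} [NormedAddCommGroup G] [NormedSpace ℝ G] (L : AlgLoop G) :
    Prop where
  contDiff_op : ContDiff ℝ ∞ (fun p : G × G => L.op p.1 p.2)
  contDiff_ldiv : ContDiff ℝ ∞ (fun p : G × G => L.ldiv p.1 p.2)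
  contDiff_rdiv : ContDiff ℝ ∞ (fun p : G × G => L.rdiv p.1 p.2)

/-- An invariant right measure on a loop: a nonzero `σ`-finite measure which is invariant under
every right translation `θ ↦ θ ∘ v`. -/
structure IsInvariantRightMeasure {G : Type*} [MeasurableSpace G] (L : AlgLoop G)
    (μ : MeasureTheory.Measure G) : Prop where
  ne_zero : μ ≠ 0
  sigmaFinite : MeasureTheory.SigmaFinite μ
  measurePreserving : ∀ v : G, MeasureTheory.MeasurePreserving (fun θ => L.op θ v) μ μ

end AlgLoop

open MeasureTheory Set

/-! For `v ≤ 0` right translation by `v` is ordinary translation, and these together with their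
inverses give all translations of `ℝ`. An invariant right measure is therefore `c • volume` with `0
< c < ∞` (`exists_eq_smul_volume`). But right translation by `1` maps `[0, π]` onto `[1, π + 2]`, of
length `π + 1`, which contradicts invariance. The perturbation is bounded and both partial
derivatives stay positive, so the loop axioms hold and the divisions are smooth. -/

/-- If `x ↦ F (a, x)` is injective with nonvanishing derivative for every `a`, then the solution
`x = G (a, b)` of `F (a, x) = b` depends smoothly on `(a, b)`. -/
theorem contDiff_of_partial_rightInverse {F G : ℝ × ℝ → ℝ} (hF : ContDiff ℝ ∞ F)
    (hinj : ∀ a, Function.Injective fun x => F (a, x))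
    (hderiv : ∀ a x, ∃ d ≠ 0, HasDerivAt (fun x => F (a, x)) d x)
    (hG : ∀ p : ℝ × ℝ, F (p.1, G p) = p.2) : ContDiff ℝ ∞ G := by
  have hn : (∞ : WithTop ℕ∞) ≠ 0 := by simp
  -- Keeping the parameter as first coordinate makes the derivative triangular with diagonal `1, d`,
  -- so the inverse function theorem applies.
  set Φ : ℝ × ℝ → ℝ × ℝ := fun p => (p.1, F p) with hΦ
  have hΦs : ContDiff ℝ ∞ Φ := contDiff_fst.prodMk hF
  have hΦinj : Function.Injective Φ := by
    rintro ⟨a, x⟩ ⟨a', x'⟩ h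
    obtain ⟨rfl, h⟩ : a = a' ∧ F (a, x) = F (a', x') := by simpa [hΦ] using h
    rw [hinj a h]
  rw [contDiff_iff_contDiffAt]
  intro p
  set q : ℝ × ℝ := (p.1, G p)
  have hΦq : Φ q = p := Prod.ext rfl (hG p)
  have hFd : HasFDerivAt F (fderiv ℝ F q) q := (hF.differentiable hn q).hasFDerivAt
  have hΦd : HasFDerivAt Φ ((ContinuousLinearMap.fst ℝ ℝ ℝ).prod (fderiv ℝ F q)) q :=
    hasFDerivAt_fst.prodMk hFd
  obtain ⟨d, hd, hd'⟩ := hderiv q.1 q.2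
  have hker : fderiv ℝ F q (0, 1) = d := by
    have hcurve : HasDerivAt (fun x : ℝ => (q.1, x)) ((0 : ℝ), (1 : ℝ)) q.2 :=
      (hasDerivAt_const _ _).prodMk (hasDerivAt_id _)
    exact (HasFDerivAt.comp_hasDerivAt q.2 (l := F) (f := fun x : ℝ => (q.1, x)) hFd hcurve).unique
      hd'
  have hLinj : Function.Injective
      (((ContinuousLinearMap.fst ℝ ℝ ℝ).prod (fderiv ℝ F q) : ℝ × ℝ →L[ℝ] ℝ × ℝ) :
        ℝ × ℝ →ₗ[ℝ] ℝ × ℝ) := by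
    rw [injective_iff_map_eq_zero]
    rintro ⟨u, w⟩ h
    obtain ⟨rfl, h⟩ : u = 0 ∧ fderiv ℝ F q (u, w) = 0 := by simpa using h
    have : ((0 : ℝ), w) = w • ((0 : ℝ), (1 : ℝ)) := by simp
    rw [this, map_smul, hker, smul_eq_mul, mul_eq_zero] at h
    simpa [hd] using h
  let A : (ℝ × ℝ) ≃L[ℝ] (ℝ × ℝ) := (LinearEquiv.ofInjectiveEndo _ hLinj).toContinuousLinearEquiv
  have hA : HasFDerivAt Φ (A : ℝ × ℝ →L[ℝ] ℝ × ℝ) q := by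
    convert hΦd using 1
    ext <;> rfl
  have hinv : ContDiffAt ℝ ∞ (hΦs.contDiffAt.localInverse hA hn) p := by
    simpa only [hΦq] using hΦs.contDiffAt.to_localInverse hA hn
  have hright := (hΦs.contDiffAt.hasStrictFDerivAt' hA hn).eventually_right_inverse
  rw [hΦq] at hright
  refine (contDiffAt_snd.comp p hinv).congr_of_eventuallyEq ?_
  filter_upwards [hright] with r hr
  -- Global injectivity of `Φ` identifies the two preimages of `r`, so continuity of `G` need not be
  -- known beforehand.
  have : hΦs.contDiffAt.localInverse hA hn r = (r.1, G r) :=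
    hΦinj (hr.trans (Prod.ext (by rfl) (hG r) : Φ (r.1, G r) = r).symm)
  simp [this]

/-- The operation `θ + v + (1 - cos θ) / 2 * h v`, with `h` a smooth transition from `0` to `1`. It
is addition for `v ≤ 0` and a nonlinear perturbation of it for `v > 0`. -/
noncomputable def perturbedAdd (θ v : ℝ) : ℝ :=
  θ + v + (1 - Real.cos θ) / 2 * Real.smoothTransition v

namespace perturbedAdd

theorem of_nonpos (θ : ℝ) {v : ℝ} (hv : v ≤ 0) : perturbedAdd θ v = θ + v := by
  simp [perturbedAdd, Real.smoothTransition.zero_of_nonpos hv]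

theorem zero_left (v : ℝ) : perturbedAdd 0 v = v := by simp [perturbedAdd]

theorem coeff_mem_Icc (θ : ℝ) : (1 - Real.cos θ) / 2 ∈ Icc (0 : ℝ) 1 := by
  constructor <;> linarith [Real.cos_le_one θ, Real.neg_one_le_cos θ]

/-- With `le_add_one`, this controls the limits at `±∞`, whence surjectivity in each variable. -/
theorem add_le (θ v : ℝ) : θ + v ≤ perturbedAdd θ v :=
  le_add_of_nonneg_right (mul_nonneg (coeff_mem_Icc θ).1 (Real.smoothTransition.nonneg v))

theorem le_add_one (θ v : ℝ) : perturbedAdd θ v ≤ θ + v + 1 :=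
  add_le_add_right (mul_le_one₀ (coeff_mem_Icc θ).2 (Real.smoothTransition.nonneg v)
    (Real.smoothTransition.le_one v)) _

theorem contDiff : ContDiff ℝ ∞ fun p : ℝ × ℝ => perturbedAdd p.1 p.2 :=
  (contDiff_fst.add contDiff_snd).add
    (((contDiff_const.sub (Real.contDiff_cos.comp contDiff_fst)).div_const 2).mul
      ((Real.smoothTransition.contDiff (n := ⊤)).comp contDiff_snd))

theorem continuous_left (v : ℝ) : Continuous fun θ => perturbedAdd θ v :=
  contDiff.continuous.comp (Continuous.prodMk_left v)

theorem continuous_right (θ : ℝ) : Continuous (perturbedAdd θ) :=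
  contDiff.continuous.comp (Continuous.prodMk_right θ)

theorem hasDerivAt_left (θ v : ℝ) : HasDerivAt (fun θ => perturbedAdd θ v)
    (1 + Real.sin θ / 2 * Real.smoothTransition v) θ := by
  have h := ((hasDerivAt_id θ).add_const v).add
    ((((Real.hasDerivAt_cos θ).const_sub 1).div_const 2).mul_const (Real.smoothTransition v))
  rwa [neg_neg] at h

/-- The factor `1/2` in the perturbation keeps this derivative at least `1/2`. -/
theorem deriv_left_pos (θ v : ℝ) : 0 < 1 + Real.sin θ / 2 * Real.smoothTransition v := by
  nlinarith [Real.neg_one_le_sin θ, Real.smoothTransition.nonneg v,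
    Real.smoothTransition.le_one v]

theorem hasDerivAt_right (θ v : ℝ) : HasDerivAt (perturbedAdd θ)
    (1 + (1 - Real.cos θ) / 2 * deriv Real.smoothTransition v) v := by
  have hd : HasDerivAt Real.smoothTransition (deriv Real.smoothTransition v) v :=
    ((Real.smoothTransition.contDiff (n := 1)).differentiable (by simp) v).hasDerivAt
  exact ((hasDerivAt_id v).const_add θ).add (hd.const_mul _)

theorem deriv_right_pos (θ v : ℝ) :
    0 < 1 + (1 - Real.cos θ) / 2 * deriv Real.smoothTransition v :=
  add_pos_of_pos_of_nonneg one_pos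
    (mul_nonneg (coeff_mem_Icc θ).1 Real.smoothTransition.monotone.deriv_nonneg)

theorem strictMono_left (v : ℝ) : StrictMono fun θ => perturbedAdd θ v :=
  strictMono_of_hasDerivAt_pos (hasDerivAt_left · v) (deriv_left_pos · v)

theorem strictMono_right (θ : ℝ) : StrictMono (perturbedAdd θ) :=
  strictMono_of_hasDerivAt_pos (hasDerivAt_right θ) (deriv_right_pos θ)

theorem bijective_left (v : ℝ) : Function.Bijective fun θ => perturbedAdd θ v := by
  refine ⟨(strictMono_left v).injective, (continuous_left v).surjective ?_ ?_⟩
  · exact Filter.tendsto_atTop_mono (fun θ => add_le θ v)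
      (Filter.tendsto_atTop_add_const_right _ v Filter.tendsto_id)
  · refine Filter.tendsto_atBot_mono (fun θ => (le_add_one θ v).trans_eq (add_assoc θ v 1))
      (Filter.tendsto_atBot_add_const_right _ (v + 1) Filter.tendsto_id)

theorem bijective_right (θ : ℝ) : Function.Bijective (perturbedAdd θ) := by
  refine ⟨(strictMono_right θ).injective, (continuous_right θ).surjective ?_ ?_⟩
  · exact Filter.tendsto_atTop_mono (add_le θ)
      (Filter.tendsto_atTop_add_const_left _ θ Filter.tendsto_id)
  · exact Filter.tendsto_atBot_mono (le_add_one θ)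
      (Filter.tendsto_atBot_add_const_right _ 1
        (Filter.tendsto_atBot_add_const_left _ θ Filter.tendsto_id))

end perturbedAdd

/-- The loop on the real line with operation `perturbedAdd`. -/
noncomputable def perturbedLoop : AlgLoop ℝ where
  op := perturbedAdd
  e := 0
  existsUnique_left a b := (perturbedAdd.bijective_right a).existsUnique b
  existsUnique_right a b := (perturbedAdd.bijective_left a).existsUnique b
  op_e a := by rw [perturbedAdd.of_nonpos a le_rfl, add_zero]
  e_op := perturbedAdd.zero_left

theorem perturbedLoop_isSmooth : perturbedLoop.IsSmooth where
  contDiff_op := perturbedAdd.contDiff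
  contDiff_ldiv := contDiff_of_partial_rightInverse perturbedAdd.contDiff
    (fun a => (perturbedAdd.bijective_right a).injective)
    (fun a x => ⟨_, (perturbedAdd.deriv_right_pos a x).ne', perturbedAdd.hasDerivAt_right a x⟩)
    (fun p => (perturbedLoop.existsUnique_left p.1 p.2).choose_spec.1)
  contDiff_rdiv := by
    have h : ContDiff ℝ ∞ fun p : ℝ × ℝ => perturbedLoop.rdiv p.2 p.1 :=
      contDiff_of_partial_rightInverse (F := fun p => perturbedAdd p.2 p.1)
        (perturbedAdd.contDiff.comp (contDiff_snd.prodMk contDiff_fst))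
        (fun a => (perturbedAdd.bijective_left a).injective)
        (fun a x => ⟨_, (perturbedAdd.deriv_left_pos x a).ne', perturbedAdd.hasDerivAt_left x a⟩)
        (fun p => (perturbedLoop.existsUnique_right p.1 p.2).choose_spec.1)
    exact h.comp (contDiff_snd.prodMk contDiff_fst)

/-- A nonzero `σ`-finite translation invariant measure on `ℝ` is a positive finite multiple of
Lebesgue measure. -/
theorem exists_eq_smul_volume (μ : Measure ℝ) [SigmaFinite μ] [μ.IsAddLeftInvariant] (hμ : μ ≠ 0) :
    ∃ c : ENNReal, c ≠ 0 ∧ c ≠ ⊤ ∧ μ = c • (volume : Measure ℝ) := by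
  have h : μ = (μ (Icc 0 1) / volume (Icc (0 : ℝ) 1)) • (volume : Measure ℝ) :=
    measure_eq_sub_vadd μ volume (by simp) (by simp)
  refine ⟨_, fun h0 => hμ (by rw [h, h0, zero_smul]), fun htop => ?_, h⟩
  rw [htop] at h
  -- If the factor were `∞`, sets of finite `μ`-measure would be Lebesgue null, yet countably many
  -- of them cover `ℝ`.
  have hnull (n : ℕ) : (volume : Measure ℝ) (spanningSets μ n) = 0 := by
    have hlt := measure_spanningSets_lt_top μ n
    by_contra hne
    have heq := congrArg (fun ν : Measure ℝ => ν (spanningSets μ n)) h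
    simp only [Measure.smul_apply, smul_eq_mul, ENNReal.top_mul hne] at heq
    exact hlt.ne heq
  have : (volume : Measure ℝ) univ = 0 := by
    rw [← iUnion_spanningSets μ]
    exact measure_iUnion_null hnull
  simp at this

theorem perturbedLoop_not_isInvariantRightMeasure (μ : Measure ℝ) :
    ¬ perturbedLoop.IsInvariantRightMeasure μ := by
  intro hμ
  have := hμ.sigmaFinite
  have hneg (v : ℝ) (hv : v ≤ 0) : μ.map (v + ·) = μ := by
    have h := (hμ.measurePreserving v).map_eq
    simpa only [perturbedLoop, perturbedAdd.of_nonpos _ hv, add_comm _ v] using h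
  have : μ.IsAddLeftInvariant := by
    refine ⟨fun v => ?_⟩
    rcases le_total v 0 with hv | hv
    · exact hneg v hv
    · conv_lhs => rw [← hneg (-v) (by linarith)]
      rw [Measure.map_map (measurable_const_add v) (measurable_const_add (-v))]
      have : (v + ·) ∘ (-v + ·) = (id : ℝ → ℝ) := by ext; simp
      rw [this, Measure.map_id]
  obtain ⟨c, hc0, hctop, rfl⟩ := exists_eq_smul_volume μ hμ.ne_zero
  -- The coefficient `(1 - cos θ) / 2` is `0` at `0` and `1` at `π`, so the interval is stretched by
  -- exactly `1`.
  have hpre : (fun θ => perturbedAdd θ 1) ⁻¹' Icc 1 (Real.pi + 2) = Icc 0 Real.pi := by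
    have h0 : perturbedAdd 0 1 = 1 := perturbedAdd.zero_left 1
    have hpi : perturbedAdd Real.pi 1 = Real.pi + 2 := by
      simp only [perturbedAdd, Real.cos_pi, Real.smoothTransition.one]
      ring
    ext θ
    simp only [mem_preimage, mem_Icc]
    rw [← hpi, (perturbedAdd.strictMono_left 1).le_iff_le]
    nth_rw 1 [← h0]
    rw [(perturbedAdd.strictMono_left 1).le_iff_le]
  have h := (hμ.measurePreserving 1).measure_preimage
    (measurableSet_Icc (a := (1 : ℝ)) (b := Real.pi + 2)).nullMeasurableSet
  change (c • volume) ((fun θ => perturbedAdd θ 1) ⁻¹' Icc 1 (Real.pi + 2)) = _ at h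
  rw [hpre, Measure.smul_apply, Measure.smul_apply, smul_eq_mul, smul_eq_mul,
    ENNReal.mul_right_inj hc0 hctop, Real.volume_Icc, Real.volume_Icc,
    ENNReal.ofReal_eq_ofReal_iff (by linarith [Real.pi_pos]) (by linarith [Real.pi_pos])] at h
  linarith

theorem theorem3 :
    ∃ L : AlgLoop ℝ, L.IsSmooth ∧
      ¬ ∃ μ : MeasureTheory.Measure ℝ, L.IsInvariantRightMeasure μ :=
  ⟨perturbedLoop, perturbedLoop_isSmooth,
    fun ⟨μ, hμ⟩ => perturbedLoop_not_isInvariantRightMeasure μ hμ⟩
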